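/- Let $d\ge 1$, let $b\in\mathcal C^2(\mathbb R^d,\mathbb R^d)$ have bounded second-order derivatives, and suppose that there is $L>0$ with $(x-y)\cdot(b(x)-b(y))\le L|x-y|^2$ for all $x,y\in\mathbb R^d$. Let $\sigma\in\mathbb R^{d\times d}$ be a constant matrix (possibly singular), let $B$ be a Brownian motion in $\mathbb R^d$, and let $(P_t)_{t\ge 0}$ be the Markov semigroup of the diffusion $\mathrm dX_t=b(X_t)\,\mathrm dt+\sigma\,\mathrm dB_t$, so that $\nu P_t$ is the law of $X_t$ when $X_0\sim\nu$ is independent of $B$. For real $p\ge 1$, let $\mathcal P_p(\mathbb R^d)$ be the set of probability measures on $\mathbb R^d$ with finite $p$-th moment, let $\mathcal W_p$ be the $L^p$ Wasserstein distance associated with the Euclidean distance, and set \[\beta_p(t)=\sup_{\nu,\mu\in\mathcal P_p(\mathbb R^d),\ \nu\ne\mu}\frac{\mathcal W_p(\nu P_t,\mu P_t)}{\mathcal W_p(\nu,\mu)},\qquad t\ge 0 .\] Let $\lambda^*=-\sup\{v\cdot\nabla b(x)v:\ x,v\in\mathbb R^d,\ |v|=1\}$ be the Bakry–Émery curvature,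 which is finite. Then, for every $p\ge 1$, the Bakry–Émery bound $\beta_p(t)\le e^{-\lambda^*t}$ holds for all $t\ge0$, and it is sharp at small times: \[\beta_p(t)=1-\lambda^*t+o(t)\qquad\text{as } t\to 0^+ .\] -/

import Mathlib

open MeasureTheory ProbabilityTheory Filter Asymptotics
open scoped NNReal ENNReal Topology

noncomputable section

namespace WassersteinContraction

/-- The basic conditions on the drift: `b` is `C²` with bounded second-order derivatives, and it is
one-sided Lipschitz. -/
structure BasicAssumption {d : ℕ}
    (b : EuclideanSpace ℝ (Fin d) → EuclideanSpace ℝ (Fin d)) : Prop where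
  contDiff : ContDiff ℝ 2 b
  bounded_second_deriv : ∃ M : ℝ, ∀ x, ‖iteratedFDeriv ℝ 2 b x‖ ≤ M
  oneSidedLipschitz : ∃ L : ℝ, 0 < L ∧ ∀ x y, inner ℝ (x - y) (b x - b y) ≤ L * ‖x - y‖ ^ 2

/-- The Bakry-Emery curvature `λ* = - sup {v · ∇b(x) v : x ∈ ℝᵈ, |v| = 1}`. -/
def bakryEmeryCurvature {d : ℕ}
    (b : EuclideanSpace ℝ (Fin d) → EuclideanSpace ℝ (Fin d)) : ℝ :=
  - sSup {r : ℝ | ∃ x v : EuclideanSpace ℝ (Fin d), ‖v‖ = 1 ∧ r = inner ℝ v (fderiv ℝ b x v)}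

/-- A standard Brownian motion in `ℝᵈ`: the coordinates are independent real Brownian motions. -/
structure IsBrownian {d : ℕ} {Ω : Type*} [MeasurableSpace Ω]
    (B : ℝ≥0 → Ω → EuclideanSpace ℝ (Fin d)) (P : Measure Ω) : Prop where
  coord : ∀ i, IsBrownianReal (fun t ω ↦ B t ω i) P
  indep : iIndepFun (fun (i : Fin d) (ω : Ω) (t : ℝ≥0) ↦ B t ω i) P

/-- `X` is a solution, started at the point `x`, of `dX_t = b(X_t) dt + σ dB_t`, i.e. a process with
almost surely continuous paths that almost surely satisfies
`X_t = x + ∫₀ᵗ b(X_s) ds + σ B_t` for all `t ≥ 0`. (As `σ` is constant, the stochastic integral is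
`σ B_t`.) -/
structure IsSolution {d : ℕ} {Ω : Type*} [MeasurableSpace Ω]
    (b : EuclideanSpace ℝ (Fin d) → EuclideanSpace ℝ (Fin d)) (σ : Matrix (Fin d) (Fin d) ℝ)
    (B : ℝ≥0 → Ω → EuclideanSpace ℝ (Fin d)) (P : Measure Ω)
    (x : EuclideanSpace ℝ (Fin d)) (X : ℝ≥0 → Ω → EuclideanSpace ℝ (Fin d)) : Prop where
  aemeasurable : ∀ t, AEMeasurable (X t) P
  continuous : ∀ᵐ ω ∂P, Continuous (fun t ↦ X t ω)
  equation : ∀ᵐ ω ∂P, ∀ t : ℝ≥0,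
    X t ω = x + (∫ s in (0 : ℝ)..(t : ℝ), b (X s.toNNReal ω))
      + Matrix.toEuclideanCLM (𝕜 := ℝ) σ (B t ω)

/-- The law `ν P_t` at time `t` of the process with initial law `ν`, where `X x` is the process
started at `x`: it is `∫ law(X_t^x) ν(dx)`. -/
def evolvedLaw {d : ℕ} {Ω : Type*} [MeasurableSpace Ω] (P : Measure Ω)
    (X : EuclideanSpace ℝ (Fin d) → ℝ≥0 → Ω → EuclideanSpace ℝ (Fin d))
    (t : ℝ≥0) (ν : Measure (EuclideanSpace ℝ (Fin d))) : Measure (EuclideanSpace ℝ (Fin d)) :=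
  ν.bind (fun x ↦ P.map (X x t))

/-- The transport plans between `ν` and `μ`. -/
def transportPlans {E : Type*} [MeasurableSpace E] (ν μ : Measure E) : Set (Measure (E × E)) :=
  {π | π.fst = ν ∧ π.snd = μ}

/-- The `L^p` Wasserstein distance, with values in `[0, ∞]`. -/
def wasserstein {E : Type*} [MeasurableSpace E] [PseudoEMetricSpace E]
    (p : ℝ) (ν μ : Measure E) : ℝ≥0∞ :=
  (⨅ π ∈ transportPlans ν μ, ∫⁻ z, edist z.1 z.2 ^ p ∂π) ^ (1 / p)

/-- The set of probability measures with finite `p`-th moment. -/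
def finiteMoment {E : Type*} [MeasurableSpace E] [NormedAddCommGroup E] (p : ℝ) :
    Set (Measure E) :=
  {ν | IsProbabilityMeasure ν ∧ ∫⁻ x, ‖x‖ₑ ^ p ∂ν < ∞}

/-- The `L^p` Wasserstein contraction coefficient
`β_p(t) = sup_{ν ≠ μ} W_p(ν P_t, μ P_t) / W_p(ν, μ)`, the supremum being over probability measures
with finite `p`-th moment. It takes values in `[0, ∞]`. -/
def contractionCoeff {d : ℕ} {Ω : Type*} [MeasurableSpace Ω] (P : Measure Ω)
    (X : EuclideanSpace ℝ (Fin d) → ℝ≥0 → Ω → EuclideanSpace ℝ (Fin d))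
    (p : ℝ) (t : ℝ≥0) : ℝ≥0∞ :=
  ⨆ (ν ∈ finiteMoment p) (μ ∈ finiteMoment p) (_ : ν ≠ μ),
    wasserstein p (evolvedLaw P X t ν) (evolvedLaw P X t μ) / wasserstein p ν μ

end WassersteinContraction

end

/-! Upper bound: couple solutions synchronously, driving them by the same Brownian motion. The noise
is additive, so it cancels in `X - Y`, which is then differentiable in time. One-sided Lipschitz
continuity of `b` with the optimal constant `-λ*` (`BasicAssumption.inner_sub_le`) and Gronwall give
`|X_t - Y_t| ≤ e^{-λ* t} |x - y|` almost surely. Transporting any plan by the joint law of the two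
solutions carries this over to `W_p` (`wasserstein_evolvedLaw_le`).

Lower bound: test with Dirac masses at `x` and `y = x + εv`, where `v · ∇b(x) v` is close to its
supremum. Since `W_p ≥ W_1` and `z ↦ v · z` is 1-Lipschitz, `W_p` dominates `v · E(Y_t - X_t)`. The
expansion `E(Y_t - X_t) = (y - x) + t (b y - b x) + O(t^{3/2})`
(`IsSolution.exists_norm_integral_sub_le`) then yields `β_p(t) ≥ 1 + r t - C t^{3/2}` for every `r <
-λ*`. The drift need not be globally Lipschitz; the expansion works because increments of `b` over
bounded displacements are (`exists_norm_sub_sub_le`). -/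

namespace WassersteinContraction

/-! ### Gronwall inequalities for the norm of a differentiable curve -/

section Gronwall

variable {E : Type*} [NormedAddCommGroup E] [InnerProductSpace ℝ E]

/-- The norm is not differentiable where `Z` vanishes, so the argument bounds the derivative of
`√(‖Z‖² + δ)` by `a` and then lets `δ → 0`. -/
theorem norm_le_add_integral_of_inner_deriv_le {Z Z' : ℝ → E} {a : ℝ → ℝ}
    (hZ : ∀ s, HasDerivAt Z (Z' s) s) (ha : Continuous a) (ha0 : ∀ s, 0 ≤ a s)
    (h : ∀ s, 0 ≤ s → inner ℝ (Z s) (Z' s) ≤ a s * ‖Z s‖) {t : ℝ} (ht : 0 ≤ t) :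
    ‖Z t‖ ≤ ‖Z 0‖ + ∫ s in (0 : ℝ)..t, a s := by
  have key : ∀ δ : ℝ, 0 < δ →
      √(‖Z t‖ ^ 2 + δ) ≤ √(‖Z 0‖ ^ 2 + δ) + ∫ s in (0 : ℝ)..t, a s := by
    intro δ hδ
    have hpos : ∀ s, 0 < ‖Z s‖ ^ 2 + δ := fun s ↦ by positivity
    have hd : ∀ s, HasDerivAt (fun s ↦ √(‖Z s‖ ^ 2 + δ) - ∫ u in (0 : ℝ)..s, a u)
        (2 * inner ℝ (Z s) (Z' s) / (2 * √(‖Z s‖ ^ 2 + δ)) - a s) s := fun s ↦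
      ((((hZ s).norm_sq).add_const δ).sqrt (hpos s).ne').sub
        (intervalIntegral.integral_hasDerivAt_right (ha.intervalIntegrable _ _)
          (ha.stronglyMeasurableAtFilter _ _) ha.continuousAt)
    have hanti : AntitoneOn (fun s ↦ √(‖Z s‖ ^ 2 + δ) - ∫ u in (0 : ℝ)..s, a u) (Set.Ici 0) := by
      refine antitoneOn_of_deriv_nonpos (convex_Ici 0)
        (fun s _ ↦ (hd s).continuousAt.continuousWithinAt)
        (fun s _ ↦ (hd s).differentiableAt.differentiableWithinAt) fun s hs ↦ ?_
      rw [interior_Ici] at hs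
      rw [(hd s).deriv, sub_nonpos, mul_div_mul_left _ _ two_ne_zero,
        div_le_iff₀ (Real.sqrt_pos.2 (hpos s))]
      refine (h s (le_of_lt hs)).trans (mul_le_mul_of_nonneg_left ?_ (ha0 s))
      exact Real.le_sqrt_of_sq_le (by linarith)
    have := hanti (Set.mem_Ici.2 le_rfl) (Set.mem_Ici.2 ht) ht
    simp only [intervalIntegral.integral_same, sub_zero] at this
    linarith
  have hlim : ∀ z : E, Tendsto (fun δ : ℝ ↦ √(‖z‖ ^ 2 + δ)) (𝓝[>] 0) (𝓝 ‖z‖) := by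
    intro z
    have : Continuous fun δ : ℝ ↦ √(‖z‖ ^ 2 + δ) := by fun_prop
    have h0 := this.tendsto 0
    simp only [add_zero, Real.sqrt_sq (norm_nonneg z)] at h0
    exact h0.mono_left nhdsWithin_le_nhds
  refine le_of_tendsto_of_tendsto (hlim (Z t)) ((hlim (Z 0)).add_const _) ?_
  filter_upwards [self_mem_nhdsWithin] with δ hδ using key δ hδ

/-- Integrating factor: for `e^{-Ks} Z s` the quadratic term disappears and the preceding lemma
applies. `K` may have either sign. -/
theorem norm_le_exp_mul_of_inner_deriv_le {Z Z' : ℝ → E} {a : ℝ → ℝ} (K : ℝ)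
    (hZ : ∀ s, HasDerivAt Z (Z' s) s) (ha : Continuous a) (ha0 : ∀ s, 0 ≤ a s)
    (h : ∀ s, 0 ≤ s → inner ℝ (Z s) (Z' s) ≤ K * ‖Z s‖ ^ 2 + a s * ‖Z s‖)
    {t : ℝ} (ht : 0 ≤ t) :
    ‖Z t‖ ≤ Real.exp (K * t) * (‖Z 0‖ + ∫ s in (0 : ℝ)..t, Real.exp (-K * s) * a s) := by
  have hexp : ∀ s : ℝ, HasDerivAt (fun s ↦ Real.exp (-K * s)) (Real.exp (-K * s) * -K) s :=
    fun s ↦ by simpa using ((hasDerivAt_id s).const_mul (-K)).exp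
  have hd : ∀ s, HasDerivAt (fun s ↦ Real.exp (-K * s) • Z s)
      (Real.exp (-K * s) • Z' s + (Real.exp (-K * s) * -K) • Z s) s :=
    fun s ↦ (hexp s).smul (hZ s)
  have := norm_le_add_integral_of_inner_deriv_le (a := fun s ↦ Real.exp (-K * s) * a s) hd
    (by fun_prop) (fun s ↦ mul_nonneg (Real.exp_pos _).le (ha0 s)) (fun s hs ↦ ?_) ht
  · simp only [norm_smul, Real.norm_eq_abs, Real.abs_exp, mul_zero, Real.exp_zero, abs_one,
      one_mul] at this
    have h1 : Real.exp (K * t) * Real.exp (-K * t) = 1 := by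
      rw [← Real.exp_add]; simp
    calc ‖Z t‖ = Real.exp (K * t) * (Real.exp (-K * t) * ‖Z t‖) := by
          rw [← mul_assoc, h1, one_mul]
      _ ≤ _ := mul_le_mul_of_nonneg_left this (Real.exp_pos _).le
  · simp only [inner_add_right, real_inner_smul_left, real_inner_smul_right, norm_smul,
      Real.norm_eq_abs, Real.abs_exp, real_inner_self_eq_norm_sq]
    have hsq := mul_le_mul_of_nonneg_left (h s hs) (sq_nonneg (Real.exp (-K * s)))
    nlinarith

end Gronwall

/-! ### Pathwise estimates for the integral equation with a fixed noise path -/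

section Paths

variable {E : Type*} [NormedAddCommGroup E] [InnerProductSpace ℝ E] [CompleteSpace E]
  {b : E → E} {W X Y : ℝ≥0 → E} {x y : E}

theorem hasDerivAt_integral_path (hb : Continuous b) (hX : Continuous X) (s : ℝ) :
    HasDerivAt (fun t : ℝ ↦ ∫ u in (0 : ℝ)..t, b (X u.toNNReal)) (b (X s.toNNReal)) s := by
  have hc : Continuous fun u : ℝ ↦ b (X u.toNNReal) := by fun_prop
  exact intervalIntegral.integral_hasDerivAt_right (hc.intervalIntegrable _ _)
    (hc.stronglyMeasurableAtFilter _ _) hc.continuousAt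

theorem norm_sub_path_le (hb : Continuous b) {K : ℝ}
    (hK : ∀ x y, inner ℝ (x - y) (b x - b y) ≤ K * ‖x - y‖ ^ 2)
    (hX : Continuous X) (hY : Continuous Y)
    (hXe : ∀ t : ℝ≥0, X t = x + (∫ s in (0 : ℝ)..(t : ℝ), b (X s.toNNReal)) + W t)
    (hYe : ∀ t : ℝ≥0, Y t = y + (∫ s in (0 : ℝ)..(t : ℝ), b (Y s.toNNReal)) + W t) (t : ℝ≥0) :
    ‖X t - Y t‖ ≤ Real.exp (K * t) * ‖x - y‖ := by
  -- The common noise `W` is left out, which makes `Z` differentiable on all of `ℝ`; it agrees with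
  -- `X - Y` only at nonnegative times.
  set Z : ℝ → E := fun t ↦ (x + ∫ s in (0 : ℝ)..t, b (X s.toNNReal)) -
    (y + ∫ s in (0 : ℝ)..t, b (Y s.toNNReal)) with hZdef
  have hZ : ∀ s, HasDerivAt Z (b (X s.toNNReal) - b (Y s.toNNReal)) s := fun s ↦
    ((hasDerivAt_integral_path hb hX s).const_add x).sub
      ((hasDerivAt_integral_path hb hY s).const_add y)
  have hZe : ∀ s : ℝ, 0 ≤ s → Z s = X s.toNNReal - Y s.toNNReal := by
    intro s hs
    rw [hXe, hYe, Real.coe_toNNReal s hs, hZdef]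
    simp
  have := norm_le_exp_mul_of_inner_deriv_le (a := fun _ ↦ 0) K hZ continuous_const
    (fun _ ↦ le_rfl) (fun s hs ↦ by simpa [hZe s hs] using hK _ _) t.2
  rw [hZe _ t.2] at this
  simpa [hZdef] using this

/-- Compare `X` with `x + W`: the difference `Z = X - x - W` is differentiable, and one-sided
Lipschitz continuity controls `b(X) - b(x + W)` against `Z`. What remains is `b` along `x + W`, so
moments of `X` reduce to moments of the noise. -/
theorem norm_path_sub_le (hb : Continuous b) {L : ℝ} (hL : 0 ≤ L)
    (hK : ∀ x y, inner ℝ (x - y) (b x - b y) ≤ L * ‖x - y‖ ^ 2)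
    (hX : Continuous X) (hW : Continuous W)
    (hXe : ∀ t : ℝ≥0, X t = x + (∫ s in (0 : ℝ)..(t : ℝ), b (X s.toNNReal)) + W t) (t : ℝ≥0) :
    ‖X t - x‖ ≤ ‖W t‖ + Real.exp (L * t) * ∫ s in (0 : ℝ)..t, ‖b (x + W s.toNNReal)‖ := by
  set Z : ℝ → E := fun t ↦ ∫ s in (0 : ℝ)..t, b (X s.toNNReal) with hZdef
  have hZe : ∀ s : ℝ, 0 ≤ s → X s.toNNReal = x + Z s + W s.toNNReal := by
    intro s hs
    rw [hXe, Real.coe_toNNReal s hs]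
  have hZt : X t - x = Z t + W t := by rw [hXe]; abel
  have hca : Continuous fun s : ℝ ↦ ‖b (x + W s.toNNReal)‖ := by fun_prop
  have := norm_le_exp_mul_of_inner_deriv_le (a := fun s ↦ ‖b (x + W s.toNNReal)‖) L
    (hasDerivAt_integral_path hb hX) hca (fun _ ↦ norm_nonneg _) (fun s hs ↦ ?_) t.2
  · have h0 : Z 0 = 0 := by simp [hZdef]
    have hmono : ∫ s in (0 : ℝ)..t, Real.exp (-L * s) * ‖b (x + W s.toNNReal)‖ ≤
        ∫ s in (0 : ℝ)..t, ‖b (x + W s.toNNReal)‖ := by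
      refine intervalIntegral.integral_mono_on t.2 (Continuous.intervalIntegrable (by fun_prop) _ _)
        (hca.intervalIntegrable _ _) fun s hs ↦ ?_
      refine mul_le_of_le_one_left (norm_nonneg _) (Real.exp_le_one_iff.2 ?_)
      nlinarith [hs.1]
    change ‖Z t‖ ≤ _ * (‖Z 0‖ + _) at this
    rw [h0, norm_zero, zero_add] at this
    rw [hZt, add_comm (‖W t‖)]
    exact (norm_add_le _ _).trans
      (by gcongr; exact this.trans (mul_le_mul_of_nonneg_left hmono (Real.exp_pos _).le))
  · change inner ℝ (Z s) _ ≤ L * ‖Z s‖ ^ 2 + _ * ‖Z s‖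
    have h1 := hK (X s.toNNReal) (x + W s.toNNReal)
    have h2 : X s.toNNReal - (x + W s.toNNReal) = Z s := by rw [hZe s hs]; abel
    rw [h2, inner_sub_right] at h1
    have h3 := real_inner_le_norm (Z s) (b (x + W s.toNNReal))
    linarith

end Paths

/-! ### Growth and increments of a drift with bounded second derivative -/

section Drift

variable {E : Type*} [NormedAddCommGroup E] [NormedSpace ℝ E] {b : E → E} {M : ℝ}

theorem norm_fderiv_sub_le (hb : ContDiff ℝ 2 b) (hM : ∀ x, ‖iteratedFDeriv ℝ 2 b x‖ ≤ M)
    (x y : E) : ‖fderiv ℝ b x - fderiv ℝ b y‖ ≤ M * ‖x - y‖ := by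
  have hd : Differentiable ℝ (fderiv ℝ b) :=
    (hb.fderiv_right (m := 1) (by norm_num)).differentiable (by norm_num)
  refine convex_univ.norm_image_sub_le_of_norm_fderiv_le (fun z _ ↦ hd z) (fun z _ ↦ ?_)
    (Set.mem_univ y) (Set.mem_univ x)
  rw [← norm_iteratedFDeriv_one, norm_iteratedFDeriv_fderiv]
  exact hM z

theorem norm_fderiv_le (hb : ContDiff ℝ 2 b) (hM : ∀ x, ‖iteratedFDeriv ℝ 2 b x‖ ≤ M)
    (x y : E) : ‖fderiv ℝ b y‖ ≤ ‖fderiv ℝ b x‖ + M * ‖y - x‖ := by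
  have := norm_fderiv_sub_le hb hM y x
  have h2 := norm_sub_norm_le (fderiv ℝ b y) (fderiv ℝ b x)
  linarith

theorem norm_sub_le_of_mem_ball (hb : ContDiff ℝ 2 b)
    (hM : ∀ x, ‖iteratedFDeriv ℝ 2 b x‖ ≤ M) (x : E) {R : ℝ} {u w : E}
    (hu : ‖u‖ ≤ R) (hw : ‖w‖ ≤ R) :
    ‖b (x + u) - b (x + w)‖ ≤ (‖fderiv ℝ b x‖ + M * R) * ‖u - w‖ := by
  have hM0 : 0 ≤ M := (norm_nonneg _).trans (hM 0)
  have := (convex_closedBall x R).norm_image_sub_le_of_norm_fderiv_le (𝕜 := ℝ) (f := b)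
    (C := ‖fderiv ℝ b x‖ + M * R) (x := x + w) (y := x + u)
    (fun z _ ↦ hb.differentiable (by norm_num) z) (fun z hz ↦ ?_) (by simpa using hw)
    (by simpa using hu)
  · simpa using this
  · rw [mem_closedBall_iff_norm] at hz
    exact (norm_fderiv_le hb hM x z).trans (by gcongr)

theorem exists_norm_le_quadratic (hb : ContDiff ℝ 2 b)
    (hM : ∀ x, ‖iteratedFDeriv ℝ 2 b x‖ ≤ M) (x : E) :
    ∃ A : ℝ, 0 ≤ A ∧ ∀ w, ‖b (x + w)‖ ≤ A * (1 + ‖w‖ ^ 2) := by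
  have hM0 : 0 ≤ M := (norm_nonneg _).trans (hM 0)
  refine ⟨‖b x‖ + ‖fderiv ℝ b x‖ + M, by positivity, fun w ↦ ?_⟩
  have h1 := norm_sub_le_of_mem_ball hb hM x (le_refl ‖w‖) (w := 0) (by simp)
  have h2 := norm_sub_norm_le (b (x + w)) (b (x + 0))
  simp only [add_zero, sub_zero] at h1 h2
  nlinarith [norm_nonneg w, norm_nonneg (b x), norm_nonneg (fderiv ℝ b x),
    mul_nonneg (norm_nonneg (b x)) (sq_nonneg ‖w‖),
    mul_nonneg (norm_nonneg (fderiv ℝ b x)) (sq_nonneg (‖w‖ - 1)),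
    mul_nonneg (norm_nonneg (fderiv ℝ b x)) (sq_nonneg ‖w‖)]

/-- Move the base point from `x` to `x'` with the displacement `h = y' - x'` fixed: the derivative
`∇b(z + h) - ∇b(z)` is at most `M K`. Then change the displacement inside the ball of radius `K`
around `x`, where `b` is Lipschitz. -/
theorem exists_norm_sub_sub_le (hb : ContDiff ℝ 2 b)
    (hM : ∀ x, ‖iteratedFDeriv ℝ 2 b x‖ ≤ M) (x y : E) {K : ℝ} (hK : ‖y - x‖ ≤ K) :
    ∃ C : ℝ, 0 ≤ C ∧ ∀ x' y', ‖y' - x'‖ ≤ K →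
      ‖(b y' - b x') - (b y - b x)‖ ≤ C * (‖x' - x‖ + ‖y' - y‖) := by
  have hM0 : 0 ≤ M := (norm_nonneg _).trans (hM 0)
  have hK0 : 0 ≤ K := (norm_nonneg _).trans hK
  refine ⟨2 * M * K + ‖fderiv ℝ b x‖, by positivity, fun x' y' h ↦ ?_⟩
  have hd := hb.differentiable (by norm_num : (2 : WithTop ℕ∞) ≠ 0)
  have h1 : ‖(b (x' + (y' - x')) - b x') - (b (x + (y' - x')) - b x)‖ ≤ M * K * ‖x' - x‖ := by
    refine convex_univ.norm_image_sub_le_of_norm_hasFDerivWithin_le (𝕜 := ℝ)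
      (f := fun z ↦ b (z + (y' - x')) - b z)
      (f' := fun z ↦ fderiv ℝ b (z + (y' - x')) - fderiv ℝ b z)
      (fun z _ ↦ ?_) (fun z _ ↦ ?_) (Set.mem_univ x) (Set.mem_univ x')
    · exact ((hasFDerivAt_comp_add_right (y' - x')).2
        (hd (z + (y' - x'))).hasFDerivAt |>.sub (hd z).hasFDerivAt).hasFDerivWithinAt
    · refine (norm_fderiv_sub_le hb hM _ _).trans ?_
      rw [add_sub_cancel_left]
      gcongr
  have h2 := norm_sub_le_of_mem_ball hb hM x h hK
  have h3 : ‖(y' - x') - (y - x)‖ ≤ ‖x' - x‖ + ‖y' - y‖ := by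
    rw [show (y' - x') - (y - x) = (y' - y) - (x' - x) by abel, add_comm]
    exact norm_sub_le _ _
  rw [add_sub_cancel] at h1 h2
  have h4 : (b y' - b x') - (b y - b x) =
      ((b y' - b x') - (b (x + (y' - x')) - b x)) + (b (x + (y' - x')) - b y) := by abel
  rw [h4]
  refine (norm_add_le _ _).trans ((add_le_add h1 (h2.trans
    (mul_le_mul_of_nonneg_left h3 (by positivity)))).trans ?_)
  nlinarith [mul_nonneg (mul_nonneg hM0 hK0) (norm_nonneg (y' - y))]

end Drift

/-! ### The curvature as the optimal one-sided Lipschitz constant -/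

section Curvature

variable {d : ℕ} {b : EuclideanSpace ℝ (Fin d) → EuclideanSpace ℝ (Fin d)}

theorem inner_fderiv_le_of_oneSidedLipschitz {E : Type*} [NormedAddCommGroup E]
    [InnerProductSpace ℝ E] {b : E → E} (hb : Differentiable ℝ b) {L : ℝ}
    (hL : ∀ x y, inner ℝ (x - y) (b x - b y) ≤ L * ‖x - y‖ ^ 2) (x v : E) :
    inner ℝ v (fderiv ℝ b x v) ≤ L * ‖v‖ ^ 2 := by
  have h1 := (hb x).hasFDerivAt.hasLineDerivAt v
  have h2 := hasDerivAt_iff_tendsto_slope.1 h1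
  have h3 : Tendsto (fun s ↦ inner ℝ v (slope (fun t : ℝ ↦ b (x + t • v)) 0 s)) (𝓝[≠] 0)
    (𝓝 (inner ℝ v (fderiv ℝ b x v))) := tendsto_const_nhds.inner h2
  refine le_of_tendsto h3 ?_
  filter_upwards [self_mem_nhdsWithin] with s hs
  have hs : s ≠ 0 := hs
  have := hL (x + s • v) x
  rw [add_sub_cancel_left, real_inner_smul_left, norm_smul, mul_pow, Real.norm_eq_abs,
    sq_abs] at this
  rw [slope_def_module, sub_zero, zero_smul, add_zero, real_inner_smul_right]
  have hs2 : 0 < s ^ 2 := by positivity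
  have h5 : s⁻¹ * inner ℝ v (b (x + s • v) - b x) =
      (s * inner ℝ v (b (x + s • v) - b x)) / s ^ 2 := by
    field_simp
  rw [h5, div_le_iff₀ hs2]
  linarith

theorem BasicAssumption.inner_fderiv_le (hb : BasicAssumption b)
    (x v : EuclideanSpace ℝ (Fin d)) (hv : ‖v‖ = 1) :
    inner ℝ v (fderiv ℝ b x v) ≤ -bakryEmeryCurvature b := by
  obtain ⟨L, -, hL⟩ := hb.oneSidedLipschitz
  rw [bakryEmeryCurvature, neg_neg]
  -- The constant `L` serves only to bound the set above, without which `sSup` would take a default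
  -- value.
  refine le_csSup ⟨L, ?_⟩ ⟨x, v, hv, rfl⟩
  rintro r ⟨x, v, hv, rfl⟩
  simpa [hv] using
    inner_fderiv_le_of_oneSidedLipschitz (hb.contDiff.differentiable (by norm_num)) hL x v

theorem exists_lt_inner_fderiv (hd : 0 < d) {r : ℝ} (hr : r < -bakryEmeryCurvature b) :
    ∃ x v : EuclideanSpace ℝ (Fin d), ‖v‖ = 1 ∧ r < inner ℝ v (fderiv ℝ b x v) := by
  rw [bakryEmeryCurvature, neg_neg] at hr
  obtain ⟨_, ⟨x, v, hv, rfl⟩, h⟩ := exists_lt_of_lt_csSup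
    (s := {r : ℝ | ∃ x v : EuclideanSpace ℝ (Fin d), ‖v‖ = 1 ∧ r = inner ℝ v (fderiv ℝ b x v)})
    -- Positive dimension supplies a unit vector, hence a nonempty set.
    ⟨_, 0, EuclideanSpace.single ⟨0, hd⟩ (1 : ℝ), by simp, rfl⟩ hr
  exact ⟨x, v, hv, h⟩

/-- Mean value inequality for `s ↦ w · b(y + s w)` on `[0, 1]`, after rescaling `w = x - y` to a
unit vector. -/
theorem BasicAssumption.inner_sub_le (hb : BasicAssumption b) (x y : EuclideanSpace ℝ (Fin d)) :
    inner ℝ (x - y) (b x - b y) ≤ -bakryEmeryCurvature b * ‖x - y‖ ^ 2 := by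
  have hdiff := hb.contDiff.differentiable (by norm_num : (2 : WithTop ℕ∞) ≠ 0)
  set w := x - y with hw
  have hder : ∀ s : ℝ, HasDerivAt (fun s : ℝ ↦ inner ℝ w (b (y + s • w)))
      (inner ℝ w (fderiv ℝ b (y + s • w) w)) s := by
    intro s
    have h1 : HasDerivAt (fun s : ℝ ↦ y + s • w) w s := by
      simpa using ((hasDerivAt_id s).smul_const w).const_add y
    have h2 := (hdiff (y + s • w)).hasFDerivAt.comp_hasDerivAt s h1
    simpa using (hasDerivAt_const s w).inner ℝ h2
  have hbound : ∀ z, inner ℝ w (fderiv ℝ b z w) ≤ -bakryEmeryCurvature b * ‖w‖ ^ 2 := by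
    intro z
    rcases eq_or_ne w 0 with h0 | h0
    · simp [h0]
    have hn : ‖w‖ ≠ 0 := norm_ne_zero_iff.2 h0
    have := hb.inner_fderiv_le z (‖w‖⁻¹ • w) (by rw [norm_smul]; simp [hn])
    rw [map_smul, real_inner_smul_left, real_inner_smul_right] at this
    have h5 : inner ℝ w (fderiv ℝ b z w) =
        (‖w‖⁻¹ * (‖w‖⁻¹ * inner ℝ w (fderiv ℝ b z w))) * ‖w‖ ^ 2 := by field_simp
    rw [h5]
    gcongr
  have := (convex_Icc (0 : ℝ) 1).image_sub_le_mul_sub_of_deriv_le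
    (fun s _ ↦ (hder s).continuousAt.continuousWithinAt)
    (fun s _ ↦ (hder s).differentiableAt.differentiableWithinAt)
    (fun s _ ↦ (hder s).deriv ▸ hbound _) 0 (by simp) 1 (by simp) zero_le_one
  rw [inner_sub_right]
  simpa [hw] using this

end Curvature

/-! ### Measurability of the transition kernel and regular versions of processes -/

section Law

/-- The laws depend weakly continuously on `s`. Closed sets generate the σ-algebra, and their
indicators are limits of thickened indicators, whose integrals are continuous in `s` by dominated
convergence. The exceptional null set may depend on `s, s'`; testing continuity along sequences
involves only countably many of them. -/
theorem measurable_map_of_ae_dist_le {S Ω E : Type*} [PseudoMetricSpace S] [MeasurableSpace S]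
    [OpensMeasurableSpace S] [MeasurableSpace Ω] {P : Measure Ω} [IsProbabilityMeasure P]
    [PseudoMetricSpace E] [MeasurableSpace E] [BorelSpace E] {F : S → Ω → E}
    (hF : ∀ s, AEMeasurable (F s) P) {C : ℝ}
    (h : ∀ s s', ∀ᵐ ω ∂P, dist (F s ω) (F s' ω) ≤ C * dist s s') :
    Measurable fun s ↦ P.map (F s) := by
  have hprob : ∀ s, IsProbabilityMeasure (P.map (F s)) :=
    fun s ↦ Measure.isProbabilityMeasure_map (hF s)
  refine Measurable.measure_of_isPiSystem_of_isProbabilityMeasure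
    (BorelSpace.measurable_eq.trans borel_eq_generateFrom_isClosed) isPiSystem_isClosed
    fun A hA ↦ ?_
  have hA : IsClosed A := hA
  have hδ : ∀ n : ℕ, 0 < 1 / ((n : ℝ) + 1) := fun n ↦ Nat.one_div_pos_of_nat
  refine measurable_of_tendsto_metrizable (f := fun (n : ℕ) s ↦
    ∫⁻ z, (thickenedIndicator (hδ n) A z : ℝ≥0∞) ∂(P.map (F s))) (fun n ↦ ?_)
    (tendsto_pi_nhds.2 fun s ↦ tendsto_lintegral_thickenedIndicator_of_isClosed _ hA hδ
      tendsto_one_div_add_atTop_nhds_zero_nat)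
  refine Continuous.measurable (continuous_iff_seqContinuous.2 fun u s hu ↦ ?_)
  have hm : Measurable fun z ↦ (thickenedIndicator (hδ n) A z : ℝ≥0∞) := by
    have := (thickenedIndicator (hδ n) A).continuous
    exact (ENNReal.continuous_coe.comp this).measurable
  simp only [Function.comp_def, lintegral_map' hm.aemeasurable (hF _)]
  refine tendsto_lintegral_of_dominated_convergence' (fun _ ↦ 1)
    (fun k ↦ hm.comp_aemeasurable (hF _)) (fun k ↦ ?_) (by simp) ?_
  · exact Eventually.of_forall fun ω ↦ by
      simpa using thickenedIndicator_le_one (hδ n) A (F (u k) ω)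
  · filter_upwards [ae_all_iff.2 fun k ↦ h (u k) s] with ω hω
    have h1 : Tendsto (fun k ↦ F (u k) ω) atTop (𝓝 (F s ω)) := by
      rw [tendsto_iff_dist_tendsto_zero]
      refine squeeze_zero (fun _ ↦ dist_nonneg) hω ?_
      simpa using (tendsto_iff_dist_tendsto_zero.1 hu).const_mul C
    exact ((ENNReal.continuous_coe.comp (thickenedIndicator (hδ n) A).continuous).tendsto _).comp h1

/-- Provides the joint measurability in time and `ω` needed for Tonelli. Outside a measurable null
set the path is continuous and agrees with measurable modifications on a countable dense set of
times, so measurability passes to every time by limits; on the null set the path is set to zero. -/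
theorem exists_continuous_measurable_version {Ω E : Type*} [MeasurableSpace Ω] {P : Measure Ω}
    [NormedAddCommGroup E] [MeasurableSpace E] [BorelSpace E]
    {Z : ℝ≥0 → Ω → E} (hZ : ∀ t, AEMeasurable (Z t) P)
    (hc : ∀ᵐ ω ∂P, Continuous fun t ↦ Z t ω) :
    ∃ Z' : ℝ≥0 → Ω → E, (∀ t, Measurable (Z' t)) ∧ (∀ ω, Continuous fun t ↦ Z' t ω) ∧
      ∀ᵐ ω ∂P, ∀ t, Z' t ω = Z t ω := by
  classical
  obtain ⟨S, hSc, hSd⟩ := TopologicalSpace.exists_countable_dense ℝ≥0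
  have hae : ∀ᵐ ω ∂P, (Continuous fun t ↦ Z t ω) ∧ ∀ q ∈ S, Z q ω = (hZ q).mk _ ω := by
    filter_upwards [hc, (ae_ball_iff hSc).2 fun q _ ↦ (hZ q).ae_eq_mk] with ω h1 h2
      using ⟨h1, h2⟩
  set N := toMeasurable P {ω | ¬((Continuous fun t ↦ Z t ω) ∧ ∀ q ∈ S, Z q ω = (hZ q).mk _ ω)}
    with hN
  have hNm : MeasurableSet N := measurableSet_toMeasurable _ _
  have hN0 : P N = 0 := by rw [hN, measure_toMeasurable]; exact hae
  have hNg : ∀ ω ∉ N, (Continuous fun t ↦ Z t ω) ∧ ∀ q ∈ S, Z q ω = (hZ q).mk _ ω := by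
    intro ω hω
    by_contra hcon
    exact hω (subset_toMeasurable _ _ hcon)
  refine ⟨fun t ↦ Nᶜ.indicator (Z t), fun t ↦ ?_, fun ω ↦ ?_, ?_⟩
  · obtain ⟨q, hqS, hq⟩ := mem_closure_iff_seq_limit.1 (hSd t)
    refine measurable_of_tendsto_metrizable
      (f := fun n ↦ Nᶜ.indicator ((hZ (q n)).mk _))
      (fun n ↦ ((hZ (q n)).measurable_mk).indicator hNm.compl) (tendsto_pi_nhds.2 fun ω ↦ ?_)
    by_cases hω : ω ∈ N
    · simp [hω]
    · have h1 := hNg ω hω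
      simp only [Set.indicator_of_mem (show ω ∈ Nᶜ from hω)]
      simp_rw [← fun n ↦ h1.2 (q n) (hqS n)]
      exact (h1.1.tendsto t).comp hq
  · by_cases hω : ω ∈ N
    · simp only [Set.indicator_of_notMem (show ω ∉ Nᶜ from fun h ↦ h hω)]
      exact continuous_const
    · simp only [Set.indicator_of_mem (show ω ∈ Nᶜ from hω)]
      exact (hNg ω hω).1
  · filter_upwards [measure_eq_zero_iff_ae_notMem.1 hN0] with ω hω t
    exact Set.indicator_of_mem (show ω ∈ Nᶜ from hω) _

end Law

/-! ### Elementary bounds on the Wasserstein distance -/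

section Wasserstein

variable {E : Type*} [MeasurableSpace E]

theorem wasserstein_le_of_mem [PseudoEMetricSpace E] {p : ℝ} (hp : 0 ≤ p) {ν μ : Measure E}
    {π : Measure (E × E)} (hπ : π ∈ transportPlans ν μ) :
    wasserstein p ν μ ≤ (∫⁻ z, edist z.1 z.2 ^ p ∂π) ^ (1 / p) :=
  ENNReal.rpow_le_rpow (iInf₂_le π hπ) (by positivity)

theorem wasserstein_dirac_le [PseudoEMetricSpace E] [OpensMeasurableSpace E]
    [SecondCountableTopology E] {p : ℝ} (hp : 1 ≤ p) (x y : E) :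
    wasserstein p (Measure.dirac x) (Measure.dirac y) ≤ edist x y := by
  have hp0 : 0 < p := by linarith
  have hm : Measurable fun z : E × E ↦ edist z.1 z.2 ^ p := measurable_edist.pow_const p
  refine (wasserstein_le_of_mem hp0.le (π := Measure.dirac (x, y))
    ⟨by simp [Measure.fst, Measure.map_dirac' measurable_fst],
      by simp [Measure.snd, Measure.map_dirac' measurable_snd]⟩).trans ?_
  rw [lintegral_dirac' _ hm, ← ENNReal.rpow_mul, mul_one_div_cancel hp0.ne', ENNReal.rpow_one]

theorem lintegral_edist_le_rpow [NormedAddCommGroup E] [BorelSpace E]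
    [SecondCountableTopology E] {p : ℝ} (hp : 1 ≤ p) (π : Measure (E × E))
    [IsProbabilityMeasure π] :
    ∫⁻ z, edist z.1 z.2 ∂π ≤ (∫⁻ z, edist z.1 z.2 ^ p ∂π) ^ (1 / p) := by
  have hm : Measurable fun z : E × E ↦ z.1 - z.2 := measurable_fst.sub measurable_snd
  simpa [eLpNorm', edist_eq_enorm_sub] using
    eLpNorm'_le_eLpNorm'_of_exponent_le one_pos hp π hm.aestronglyMeasurable

/-- The easy half of Kantorovich duality, with the 1-Lipschitz function `z ↦ v · z`: under any plan
the difference of means is at most the mean distance, hence at most the `L^p` cost. -/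
theorem ofReal_inner_integral_sub_le_wasserstein [NormedAddCommGroup E] [InnerProductSpace ℝ E]
    [CompleteSpace E] [BorelSpace E] [SecondCountableTopology E] {p : ℝ} (hp : 1 ≤ p)
    {ν μ : Measure E} [IsProbabilityMeasure ν] (hν : Integrable id ν) (hμ : Integrable id μ)
    {v : E} (hv : ‖v‖ ≤ 1) :
    ENNReal.ofReal (inner ℝ v (∫ x, x ∂ν - ∫ x, x ∂μ)) ≤ wasserstein p ν μ := by
  have hp0 : 0 < p := by linarith
  have h1p : (1 / p) ≠ 0 := (by positivity : (0 : ℝ) < 1 / p).ne'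
  rw [← ENNReal.rpow_le_rpow_iff hp0, wasserstein, ← ENNReal.rpow_mul,
    one_div_mul_cancel hp0.ne', ENNReal.rpow_one]
  refine le_iInf₂ fun π hπ ↦ ?_
  have : IsProbabilityMeasure π := by
    constructor
    rw [← Measure.fst_univ, hπ.1, measure_univ]
  have hi1 : Integrable (fun z : E × E ↦ z.1) π := by
    have : Integrable id (π.map Prod.fst) := by rw [← Measure.fst, hπ.1]; exact hν
    exact this.comp_measurable measurable_fst
  have hi2 : Integrable (fun z : E × E ↦ z.2) π := by
    have : Integrable id (π.map Prod.snd) := by rw [← Measure.snd, hπ.2]; exact hμ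
    exact this.comp_measurable measurable_snd
  have he1 : ∫ x, x ∂ν = ∫ z, z.1 ∂π := by
    rw [← hπ.1, Measure.fst, integral_map measurable_fst.aemeasurable (by fun_prop)]
  have he2 : ∫ x, x ∂μ = ∫ z, z.2 ∂π := by
    rw [← hπ.2, Measure.snd, integral_map measurable_snd.aemeasurable (by fun_prop)]
  have hle : ENNReal.ofReal (inner ℝ v (∫ x, x ∂ν - ∫ x, x ∂μ)) ≤
      ∫⁻ z, edist z.1 z.2 ∂π := by
    rw [he1, he2, ← integral_sub hi1 hi2]
    refine (ENNReal.ofReal_le_ofReal ((real_inner_le_norm _ _).trans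
      (mul_le_of_le_one_left (norm_nonneg _) hv))).trans ?_
    rw [ofReal_norm]
    refine (enorm_integral_le_lintegral_enorm _).trans_eq ?_
    simp [edist_eq_enorm_sub]
  refine (ENNReal.rpow_le_rpow (hle.trans (lintegral_edist_le_rpow hp π)) hp0.le).trans_eq ?_
  rw [← ENNReal.rpow_mul, one_div_mul_cancel hp0.ne', ENNReal.rpow_one]

end Wasserstein

variable {d : ℕ} {b : EuclideanSpace ℝ (Fin d) → EuclideanSpace ℝ (Fin d)}
  {σ : Matrix (Fin d) (Fin d) ℝ} {Ω : Type*} [MeasurableSpace Ω] {P : Measure Ω}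
  {B : ℝ≥0 → Ω → EuclideanSpace ℝ (Fin d)}

/-! ### Synchronous coupling and the Bakry–Émery bound -/

section UpperBound

theorem IsSolution.ae_norm_sub_le (hb : BasicAssumption b)
    {x y : EuclideanSpace ℝ (Fin d)} {X Y : ℝ≥0 → Ω → EuclideanSpace ℝ (Fin d)}
    (hX : IsSolution b σ B P x X) (hY : IsSolution b σ B P y Y) :
    ∀ᵐ ω ∂P, ∀ t : ℝ≥0,
      ‖X t ω - Y t ω‖ ≤ Real.exp (-bakryEmeryCurvature b * t) * ‖x - y‖ := by
  filter_upwards [hX.continuous, hX.equation, hY.continuous, hY.equation] with ω h1 h2 h3 h4 t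
  exact norm_sub_path_le hb.contDiff.continuous hb.inner_sub_le h1 h3 h2 h4 t

variable [IsProbabilityMeasure P]
  {X : EuclideanSpace ℝ (Fin d) → ℝ≥0 → Ω → EuclideanSpace ℝ (Fin d)}

theorem measurable_law (hb : BasicAssumption b) (hX : ∀ x, IsSolution b σ B P x (X x))
    (t : ℝ≥0) : Measurable fun x ↦ P.map (X x t) := by
  refine measurable_map_of_ae_dist_le (fun x ↦ (hX x).aemeasurable t)
    (C := Real.exp (-bakryEmeryCurvature b * t)) fun x y ↦ ?_
  filter_upwards [(hX x).ae_norm_sub_le hb (hX y)] with ω h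
  simpa [dist_eq_norm] using h t

theorem measurable_law_prod (hb : BasicAssumption b) (hX : ∀ x, IsSolution b σ B P x (X x))
    (t : ℝ≥0) : Measurable fun z : EuclideanSpace ℝ (Fin d) × EuclideanSpace ℝ (Fin d) ↦
      P.map (fun ω ↦ (X z.1 t ω, X z.2 t ω)) := by
  refine measurable_map_of_ae_dist_le
    (fun z ↦ ((hX z.1).aemeasurable t).prodMk ((hX z.2).aemeasurable t))
    (C := Real.exp (-bakryEmeryCurvature b * t)) fun z w ↦ ?_
  filter_upwards [(hX z.1).ae_norm_sub_le hb (hX w.1), (hX z.2).ae_norm_sub_le hb (hX w.2)]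
    with ω h1 h2
  rw [Prod.dist_eq, Prod.dist_eq, mul_max_of_nonneg _ _ (Real.exp_pos _).le]
  exact max_le_max (by simpa [dist_eq_norm] using h1 t) (by simpa [dist_eq_norm] using h2 t)

/-- The synchronous coupling: draw the starting points from `π`, then run both solutions with the
same Brownian motion. -/
theorem bind_law_prod_mem_transportPlans (hb : BasicAssumption b)
    (hX : ∀ x, IsSolution b σ B P x (X x)) (t : ℝ≥0)
    {ν μ : Measure (EuclideanSpace ℝ (Fin d))}
    {π : Measure (EuclideanSpace ℝ (Fin d) × EuclideanSpace ℝ (Fin d))}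
    (hπ : π ∈ transportPlans ν μ) :
    π.bind (fun z ↦ P.map (fun ω ↦ (X z.1 t ω, X z.2 t ω))) ∈
      transportPlans (evolvedLaw P X t ν) (evolvedLaw P X t μ) := by
  have hG := measurable_law_prod hb hX t
  have hF := measurable_law hb hX t
  have hFA : ∀ {A}, MeasurableSet A → Measurable fun x ↦ P.map (X x t) A :=
    fun hA ↦ (Measure.measurable_coe hA).comp hF
  have hpair : ∀ z : EuclideanSpace ℝ (Fin d) × EuclideanSpace ℝ (Fin d),
      AEMeasurable (fun ω ↦ (X z.1 t ω, X z.2 t ω)) P :=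
    fun z ↦ ((hX z.1).aemeasurable t).prodMk ((hX z.2).aemeasurable t)
  constructor
  · ext A hA
    rw [Measure.fst_apply hA, Measure.bind_apply (measurable_fst hA) hG.aemeasurable, evolvedLaw,
      Measure.bind_apply hA hF.aemeasurable, ← hπ.1, Measure.fst,
      lintegral_map (hFA hA) measurable_fst]
    refine lintegral_congr fun z ↦ ?_
    rw [Measure.map_apply_of_aemeasurable (hpair z) (measurable_fst hA),
      Measure.map_apply_of_aemeasurable ((hX z.1).aemeasurable t) hA]
    rfl
  · ext A hA
    rw [Measure.snd_apply hA, Measure.bind_apply (measurable_snd hA) hG.aemeasurable, evolvedLaw,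
      Measure.bind_apply hA hF.aemeasurable, ← hπ.2, Measure.snd,
      lintegral_map (hFA hA) measurable_snd]
    refine lintegral_congr fun z ↦ ?_
    rw [Measure.map_apply_of_aemeasurable (hpair z) (measurable_snd hA),
      Measure.map_apply_of_aemeasurable ((hX z.2).aemeasurable t) hA]
    rfl

theorem wasserstein_evolvedLaw_le (hb : BasicAssumption b)
    (hX : ∀ x, IsSolution b σ B P x (X x)) {p : ℝ} (hp : 1 ≤ p) (t : ℝ≥0)
    (ν μ : Measure (EuclideanSpace ℝ (Fin d))) :
    wasserstein p (evolvedLaw P X t ν) (evolvedLaw P X t μ) ≤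
      ENNReal.ofReal (Real.exp (-bakryEmeryCurvature b * t)) * wasserstein p ν μ := by
  have hp0 : 0 < p := by linarith
  set c := ENNReal.ofReal (Real.exp (-bakryEmeryCurvature b * t)) with hc
  have hc0 : c ^ p ≠ 0 := by
    rw [hc, Ne, ENNReal.rpow_eq_zero_iff_of_pos hp0]
    simpa using Real.exp_pos _
  have hc1 : c ^ p ≠ ∞ := ENNReal.rpow_ne_top_of_nonneg hp0.le ENNReal.ofReal_ne_top
  have hm : Measurable fun z : EuclideanSpace ℝ (Fin d) × EuclideanSpace ℝ (Fin d) ↦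
    edist z.1 z.2 ^ p := measurable_edist.pow_const p
  have hinf : ∀ ν μ : Measure (EuclideanSpace ℝ (Fin d)), wasserstein p ν μ ^ p =
      ⨅ π ∈ transportPlans ν μ, ∫⁻ z, edist z.1 z.2 ^ p ∂π := by
    intro ν μ
    rw [wasserstein, ← ENNReal.rpow_mul, one_div_mul_cancel hp0.ne', ENNReal.rpow_one]
  rw [← ENNReal.rpow_le_rpow_iff hp0, ENNReal.mul_rpow_of_nonneg _ _ hp0.le, hinf, hinf]
  -- With the constant inside the infimum, plans can be compared one by one, so no optimal plan is
  -- needed.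
  simp_rw [ENNReal.mul_iInf_of_ne hc0 hc1]
  refine le_iInf₂ fun π hπ ↦
    (iInf₂_le _ (bind_law_prod_mem_transportPlans hb hX t hπ)).trans ?_
  rw [Measure.lintegral_bind (measurable_law_prod hb hX t).aemeasurable hm.aemeasurable,
    ← lintegral_const_mul _ hm]
  refine lintegral_mono fun z ↦ ?_
  rw [lintegral_map' hm.aemeasurable (((hX z.1).aemeasurable t).prodMk ((hX z.2).aemeasurable t))]
  have hae : ∀ᵐ ω ∂P, edist (X z.1 t ω) (X z.2 t ω) ^ p ≤ c ^ p * edist z.1 z.2 ^ p := by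
    filter_upwards [(hX z.1).ae_norm_sub_le hb (hX z.2)] with ω h
    rw [← ENNReal.mul_rpow_of_nonneg _ _ hp0.le]
    refine ENNReal.rpow_le_rpow ?_ hp0.le
    rw [edist_dist, edist_dist, hc, ← ENNReal.ofReal_mul (Real.exp_pos _).le, dist_eq_norm,
      dist_eq_norm]
    exact ENNReal.ofReal_le_ofReal (h t)
  exact (lintegral_mono_ae hae).trans_eq (by simp)

theorem contractionCoeff_le (hb : BasicAssumption b)
    (hX : ∀ x, IsSolution b σ B P x (X x)) {p : ℝ} (hp : 1 ≤ p) (t : ℝ≥0) :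
    contractionCoeff P X p t ≤ ENNReal.ofReal (Real.exp (-bakryEmeryCurvature b * t)) :=
  iSup₂_le fun ν _ ↦ iSup₂_le fun μ _ ↦ iSup_le fun _ ↦
    ENNReal.div_le_of_le_mul (wasserstein_evolvedLaw_le hb hX hp t ν μ)

end UpperBound

/-! ### Short-time first moment of the displacement -/

section Moments

theorem lintegral_intervalIntegral_le [SFinite P] {f : ℝ → Ω → ℝ} (hf : ∀ s, Measurable (f s))
    (hc : ∀ ω, Continuous fun s ↦ f s ω) (h0 : ∀ s ω, 0 ≤ f s ω) {t c : ℝ} (ht : 0 ≤ t)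
    (h : ∀ s ∈ Set.Ioc 0 t, ∫⁻ ω, ENNReal.ofReal (f s ω) ∂P ≤ ENNReal.ofReal c) :
    ∫⁻ ω, ENNReal.ofReal (∫ s in (0 : ℝ)..t, f s ω) ∂P ≤ ENNReal.ofReal (t * c) := by
  have hjoint : Measurable (Function.uncurry fun ω s ↦ f s ω) :=
    (measurable_uncurry_of_continuous_of_measurable (u := f) hc hf).comp measurable_swap
  have h1 : ∀ ω, ENNReal.ofReal (∫ s in (0 : ℝ)..t, f s ω) =
      ∫⁻ s in Set.Ioc 0 t, ENNReal.ofReal (f s ω) := by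
    intro ω
    rw [intervalIntegral.integral_of_le ht, ofReal_integral_eq_lintegral_ofReal
      ((hc ω).integrableOn_Ioc) (Eventually.of_forall fun s ↦ h0 s ω)]
  simp_rw [h1]
  rw [lintegral_lintegral_swap (hjoint.ennreal_ofReal.aemeasurable)]
  calc ∫⁻ s in Set.Ioc 0 t, ∫⁻ ω, ENNReal.ofReal (f s ω) ∂P
      ≤ ∫⁻ _ in Set.Ioc 0 t, ENNReal.ofReal c :=
        setLIntegral_mono' measurableSet_Ioc h
    _ = ENNReal.ofReal (t * c) := by
        rw [setLIntegral_const, Real.volume_Ioc, sub_zero, ENNReal.ofReal_mul ht, mul_comm]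

theorem IsBrownian.aemeasurable (hB : IsBrownian B P) (t : ℝ≥0) : AEMeasurable (B t) P := by
  have h : AEMeasurable (fun ω i ↦ B t ω i) P :=
    aemeasurable_pi_lambda _ fun i ↦ (hB.coord i).toIsPreBrownianReal.aemeasurable t
  exact (MeasurableEquiv.toLp 2 (Fin d → ℝ)).measurable.comp_aemeasurable h

theorem IsBrownian.ae_continuous (hB : IsBrownian B P) :
    ∀ᵐ ω ∂P, Continuous fun t ↦ B t ω := by
  filter_upwards [ae_all_iff.2 fun i ↦ (hB.coord i).cont] with ω h
  exact (PiLp.continuous_toLp 2 (fun _ : Fin d ↦ ℝ)).comp (continuous_pi h)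

theorem IsBrownian.lintegral_norm_sq (hB : IsBrownian B P) (t : ℝ≥0) :
    ∫⁻ ω, ENNReal.ofReal (‖B t ω‖ ^ 2) ∂P = ENNReal.ofReal (d * t) := by
  have hi : ∀ i, MemLp (fun ω ↦ B t ω i) 2 P := fun i ↦
    ((hB.coord i).toIsPreBrownianReal.hasLaw_eval t).hasGaussianLaw.memLp_two
  have h1 : ∀ i, ∫ ω, (B t ω i) ^ 2 ∂P = t := by
    intro i
    have hl := (hB.coord i).toIsPreBrownianReal.hasLaw_eval t
    have h2 := variance_of_integral_eq_zero hl.aemeasurable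
      ((hB.coord i).toIsPreBrownianReal.integral_eval t)
    rw [hl.variance_eq, variance_id_gaussianReal] at h2
    exact h2.symm
  rw [← ofReal_integral_eq_lintegral_ofReal]
  · simp_rw [EuclideanSpace.real_norm_sq_eq]
    rw [integral_finsetSum _ fun i _ ↦ (hi i).integrable_sq]
    simp [h1]
  · simp_rw [EuclideanSpace.real_norm_sq_eq]
    exact integrable_finsetSum _ fun i _ ↦ (hi i).integrable_sq
  · exact Eventually.of_forall fun ω ↦ by positivity

theorem IsBrownian.lintegral_norm_le [IsProbabilityMeasure P] (hB : IsBrownian B P) (t : ℝ≥0) :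
    ∫⁻ ω, ENNReal.ofReal ‖B t ω‖ ∂P ≤ ENNReal.ofReal (√d * √t) := by
  have h := eLpNorm'_le_eLpNorm'_of_exponent_le one_pos one_le_two P
    (hB.aemeasurable t).aestronglyMeasurable
  have h2 := hB.lintegral_norm_sq t
  simp_rw [ENNReal.ofReal_pow (norm_nonneg _), ofReal_norm] at h2
  simp only [eLpNorm', ENNReal.rpow_one, div_one, ENNReal.rpow_ofNat, h2] at h
  simp_rw [ofReal_norm]
  refine h.trans_eq ?_
  rw [ENNReal.ofReal_rpow_of_nonneg (by positivity) (by positivity), ← Real.sqrt_eq_rpow,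
    Real.sqrt_mul (by positivity)]

/-- The noise contributes order `√t`. The drift along `x + σB` contributes order `t ≤ √t`, because
`b` grows at most quadratically and `B` has second moments. -/
theorem IsSolution.exists_lintegral_norm_sub_le [IsProbabilityMeasure P] (hb : BasicAssumption b)
    (hB : IsBrownian B P) {x : EuclideanSpace ℝ (Fin d)}
    {X : ℝ≥0 → Ω → EuclideanSpace ℝ (Fin d)} (hX : IsSolution b σ B P x X) :
    ∃ K : ℝ, 0 ≤ K ∧ ∀ t : ℝ≥0, t ≤ 1 →
      ∫⁻ ω, ENNReal.ofReal ‖X t ω - x‖ ∂P ≤ ENNReal.ofReal (K * √t) := by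
  obtain ⟨M, hM⟩ := hb.bounded_second_deriv
  obtain ⟨L, hL0, hL⟩ := hb.oneSidedLipschitz
  obtain ⟨A, hA0, hA⟩ := exists_norm_le_quadratic hb.contDiff hM x
  obtain ⟨B', hB'm, hB'c, hB'e⟩ :=
    exists_continuous_measurable_version hB.aemeasurable hB.ae_continuous
  set S := Matrix.toEuclideanCLM (𝕜 := ℝ) σ with hS
  -- Bound for `E|b(x + σB_s)|` when `s ≤ 1`, from quadratic growth and `E|B_s|² = d s ≤ d`.
  set c := A * (1 + ‖S‖ ^ 2 * d) with hc
  have hc0 : 0 ≤ c := by positivity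
  have hbc := hb.contDiff.continuous
  refine ⟨‖S‖ * √d + Real.exp L * c, by positivity, fun t ht ↦ ?_⟩
  have ht1 : (t : ℝ) ≤ 1 := by exact_mod_cast ht
  have hpath : ∀ᵐ ω ∂P, ENNReal.ofReal ‖X t ω - x‖ ≤
      ENNReal.ofReal ‖S‖ * ENNReal.ofReal ‖B t ω‖ + ENNReal.ofReal (Real.exp L) *
        ENNReal.ofReal (∫ s in (0 : ℝ)..t, ‖b (x + S (B' s.toNNReal ω))‖) := by
    filter_upwards [hX.continuous, hX.equation, hB'e] with ω h1 h2 h3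
    have hI : 0 ≤ ∫ s in (0 : ℝ)..t, ‖b (x + S (B' s.toNNReal ω))‖ :=
      intervalIntegral.integral_nonneg t.2 fun _ _ ↦ norm_nonneg _
    rw [← ENNReal.ofReal_mul (norm_nonneg _), ← ENNReal.ofReal_mul (Real.exp_pos _).le,
      ← ENNReal.ofReal_add (by positivity) (mul_nonneg (Real.exp_pos _).le hI)]
    have h4 := norm_path_sub_le (W := fun t ↦ S (B' t ω)) hbc hL0.le hL h1
      (S.continuous.comp (hB'c ω)) (fun t ↦ by rw [h2 t, h3 t]) t
    refine ENNReal.ofReal_le_ofReal (h4.trans ?_)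
    rw [h3 t]
    gcongr
    · exact S.le_opNorm _
    · nlinarith
  have hdrift : ∀ s ∈ Set.Ioc (0 : ℝ) t,
      ∫⁻ ω, ENNReal.ofReal ‖b (x + S (B' s.toNNReal ω))‖ ∂P ≤ ENNReal.ofReal c := by
    intro s hs
    have hsq : ∫⁻ ω, ENNReal.ofReal (‖B' s.toNNReal ω‖ ^ 2) ∂P ≤ ENNReal.ofReal d := by
      have : ∫⁻ ω, ENNReal.ofReal (‖B' s.toNNReal ω‖ ^ 2) ∂P =
          ∫⁻ ω, ENNReal.ofReal (‖B s.toNNReal ω‖ ^ 2) ∂P :=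
        lintegral_congr_ae (by filter_upwards [hB'e] with ω h; rw [h])
      rw [this, hB.lintegral_norm_sq]
      refine ENNReal.ofReal_le_ofReal (mul_le_of_le_one_right (by positivity) ?_)
      rw [Real.coe_toNNReal _ hs.1.le]
      exact hs.2.trans ht1
    calc ∫⁻ ω, ENNReal.ofReal ‖b (x + S (B' s.toNNReal ω))‖ ∂P
        ≤ ∫⁻ ω, (ENNReal.ofReal A + ENNReal.ofReal (A * ‖S‖ ^ 2) *
            ENNReal.ofReal (‖B' s.toNNReal ω‖ ^ 2)) ∂P := by
          refine lintegral_mono fun ω ↦ ?_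
          rw [← ENNReal.ofReal_mul (by positivity), ← ENNReal.ofReal_add hA0 (by positivity)]
          refine ENNReal.ofReal_le_ofReal ((hA _).trans ?_)
          have := pow_le_pow_left₀ (norm_nonneg _) (S.le_opNorm (B' s.toNNReal ω)) 2
          rw [mul_pow] at this
          nlinarith
      _ = ENNReal.ofReal A + ENNReal.ofReal (A * ‖S‖ ^ 2) *
            ∫⁻ ω, ENNReal.ofReal (‖B' s.toNNReal ω‖ ^ 2) ∂P := by
          rw [lintegral_add_left measurable_const, lintegral_const_mul]
          · simp
          · exact ((hB'm _).norm.pow_const 2).ennreal_ofReal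
      _ ≤ ENNReal.ofReal A + ENNReal.ofReal (A * ‖S‖ ^ 2) * ENNReal.ofReal d := by gcongr
      _ = ENNReal.ofReal c := by
          rw [← ENNReal.ofReal_mul (by positivity), ← ENNReal.ofReal_add hA0 (by positivity), hc]
          ring_nf
  have hint := lintegral_intervalIntegral_le (P := P)
    (f := fun s ω ↦ ‖b (x + S (B' s.toNNReal ω))‖)
    (fun s ↦ (hbc.measurable.comp ((S.continuous.measurable.comp (hB'm _)).const_add x)).norm)
    (fun ω ↦ by have := hB'c ω; fun_prop) (fun _ _ ↦ norm_nonneg _) t.2 hdrift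
  have hst : (t : ℝ) ≤ √t := Real.le_sqrt_of_sq_le (by nlinarith [t.2])
  calc ∫⁻ ω, ENNReal.ofReal ‖X t ω - x‖ ∂P
      ≤ _ := lintegral_mono_ae hpath
    _ = ENNReal.ofReal ‖S‖ * ∫⁻ ω, ENNReal.ofReal ‖B t ω‖ ∂P + ENNReal.ofReal (Real.exp L) *
        ∫⁻ ω, ENNReal.ofReal (∫ s in (0 : ℝ)..t, ‖b (x + S (B' s.toNNReal ω))‖) ∂P := by
        have hmB : AEMeasurable (fun ω ↦ ENNReal.ofReal ‖B t ω‖) P :=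
          (hB.aemeasurable t).norm.ennreal_ofReal
        rw [lintegral_add_left' (hmB.const_mul _), lintegral_const_mul'' _ hmB,
          lintegral_const_mul' _ _ ENNReal.ofReal_ne_top]
    _ ≤ ENNReal.ofReal ‖S‖ * ENNReal.ofReal (√d * √t) + ENNReal.ofReal (Real.exp L) *
        ENNReal.ofReal (t * c) := by
        gcongr
        · exact hB.lintegral_norm_le t
        · exact hint
    _ = ENNReal.ofReal (‖S‖ * (√d * √t) + Real.exp L * (t * c)) := by
        rw [← ENNReal.ofReal_mul (norm_nonneg _), ← ENNReal.ofReal_mul (Real.exp_pos _).le,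
          ← ENNReal.ofReal_add (by positivity) (by positivity)]
    _ ≤ _ := by
        refine ENNReal.ofReal_le_ofReal ?_
        have := mul_le_mul_of_nonneg_left hst (mul_nonneg (Real.exp_pos L).le hc0)
        linarith

end Moments

/-! ### Mean expansion and the Dirac test measures -/

section LowerBound

variable [IsProbabilityMeasure P]
  {X : EuclideanSpace ℝ (Fin d) → ℝ≥0 → Ω → EuclideanSpace ℝ (Fin d)}

theorem IsSolution.integrable (hb : BasicAssumption b) (hB : IsBrownian B P)
    {x : EuclideanSpace ℝ (Fin d)} {X : ℝ≥0 → Ω → EuclideanSpace ℝ (Fin d)}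
    (hX : IsSolution b σ B P x X) {t : ℝ≥0} (ht : t ≤ 1) : Integrable (X t) P := by
  obtain ⟨K, -, hK⟩ := hX.exists_lintegral_norm_sub_le hb hB
  have h : Integrable (fun ω ↦ X t ω - x) P := by
    refine ⟨((hX.aemeasurable t).sub_const x).aestronglyMeasurable, ?_⟩
    rw [hasFiniteIntegral_iff_norm]
    exact (hK t ht).trans_lt ENNReal.ofReal_lt_top
  exact (h.add (integrable_const x)).congr (Eventually.of_forall fun ω ↦ by simp)

/-- The noise cancels in `Y - X`, so the error is the time integral of `(b(Y_s) - b(X_s)) - (b y - b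
x)`. Its mean is at most a multiple of `E|X_s - x| + E|Y_s - y|`, of order `√s`. -/
theorem IsSolution.exists_norm_integral_sub_le (hb : BasicAssumption b) (hB : IsBrownian B P)
    {x y : EuclideanSpace ℝ (Fin d)} {X Y : ℝ≥0 → Ω → EuclideanSpace ℝ (Fin d)}
    (hX : IsSolution b σ B P x X) (hY : IsSolution b σ B P y Y) :
    ∃ C : ℝ, 0 ≤ C ∧ ∀ t : ℝ≥0, t ≤ 1 →
      ‖(∫ ω, Y t ω ∂P - ∫ ω, X t ω ∂P) - ((y - x) + (t : ℝ) • (b y - b x))‖ ≤ C * (t * √t) := by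
  obtain ⟨M, hM⟩ := hb.bounded_second_deriv
  obtain ⟨Kx, hKx0, hKx⟩ := hX.exists_lintegral_norm_sub_le hb hB
  obtain ⟨Ky, hKy0, hKy⟩ := hY.exists_lintegral_norm_sub_le hb hB
  obtain ⟨X', hX'm, hX'c, hX'e⟩ :=
    exists_continuous_measurable_version hX.aemeasurable hX.continuous
  obtain ⟨Y', hY'm, hY'c, hY'e⟩ :=
    exists_continuous_measurable_version hY.aemeasurable hY.continuous
  -- By the synchronous estimate, this `K` bounds `|Y_s - X_s|` for all `s ≤ 1`, whatever the sign
  -- of the curvature.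
  obtain ⟨C, hC0, hC⟩ := exists_norm_sub_sub_le hb.contDiff hM x y
    (K := Real.exp |bakryEmeryCurvature b| * ‖y - x‖)
    (le_mul_of_one_le_left (norm_nonneg _) (Real.one_le_exp (abs_nonneg _)))
  have hbc := hb.contDiff.continuous
  refine ⟨C * (Kx + Ky), by positivity, fun t ht ↦ ?_⟩
  have ht1 : (t : ℝ) ≤ 1 := by exact_mod_cast ht
  have hXi := hX.integrable hb hB ht
  have hYi := hY.integrable hb hB ht
  set f : ℝ → Ω → ℝ := fun s ω ↦ C * (‖X' s.toNNReal ω - x‖ + ‖Y' s.toNNReal ω - y‖) with hf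
  have hfc : ∀ ω, Continuous fun s ↦ f s ω := fun ω ↦ by
    have := hX'c ω
    have := hY'c ω
    fun_prop
  have hpath : ∀ᵐ ω ∂P, ‖(Y t ω - X t ω) - ((y - x) + (t : ℝ) • (b y - b x))‖ ≤
      ∫ s in (0 : ℝ)..t, f s ω := by
    filter_upwards [hX'e, hY'e, hX.equation, hY.equation, hY.ae_norm_sub_le hb hX]
      with ω h1 h2 h3 h4 h5
    simp only [← h1, ← h2] at h3 h4 h5
    have hcx : Continuous fun s : ℝ ↦ b (X' s.toNNReal ω) := by
      have := hX'c ω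
      fun_prop
    have hcy : Continuous fun s : ℝ ↦ b (Y' s.toNNReal ω) := by
      have := hY'c ω
      fun_prop
    have hcd : Continuous fun s : ℝ ↦ b (Y' s.toNNReal ω) - b (X' s.toNNReal ω) := hcy.sub hcx
    have heq : (Y t ω - X t ω) - ((y - x) + (t : ℝ) • (b y - b x)) =
        ∫ s in (0 : ℝ)..t, ((b (Y' s.toNNReal ω) - b (X' s.toNNReal ω)) - (b y - b x)) := by
      rw [intervalIntegral.integral_sub (hcd.intervalIntegrable _ _)
        (continuous_const.intervalIntegrable _ _),
        intervalIntegral.integral_sub (hcy.intervalIntegrable _ _) (hcx.intervalIntegrable _ _),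
        intervalIntegral.integral_const, sub_zero, ← h1, ← h2, h3, h4]
      abel
    rw [heq]
    refine (intervalIntegral.norm_integral_le_integral_norm t.2).trans ?_
    refine intervalIntegral.integral_mono_on t.2
      ((hcd.sub continuous_const).norm.intervalIntegrable _ _)
      ((hfc ω).intervalIntegrable _ _) fun s hs ↦ ?_
    refine hC _ _ ((h5 _).trans ?_)
    gcongr
    rw [Real.coe_toNNReal _ hs.1]
    refine (le_abs_self _).trans ?_
    rw [abs_mul, abs_neg, abs_of_nonneg hs.1]
    exact mul_le_of_le_one_right (abs_nonneg _) (hs.2.trans ht1)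
  have hmX : ∀ s, Measurable fun ω ↦ ENNReal.ofReal ‖X' s ω - x‖ :=
    fun s ↦ ((hX'm s).sub_const x).norm.ennreal_ofReal
  have hmY : ∀ s, Measurable fun ω ↦ ENNReal.ofReal ‖Y' s ω - y‖ :=
    fun s ↦ ((hY'm s).sub_const y).norm.ennreal_ofReal
  have hbound : ∀ s ∈ Set.Ioc (0 : ℝ) t,
      ∫⁻ ω, ENNReal.ofReal (f s ω) ∂P ≤ ENNReal.ofReal (C * (Kx + Ky) * √t) := by
    intro s hs
    have hs1 : s.toNNReal ≤ 1 := by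
      rw [Real.toNNReal_le_one]
      exact hs.2.trans ht1
    have hsq : √(s.toNNReal : ℝ) ≤ √t := by
      rw [Real.coe_toNNReal _ hs.1.le]
      exact Real.sqrt_le_sqrt hs.2
    have hx : ∫⁻ ω, ENNReal.ofReal ‖X' s.toNNReal ω - x‖ ∂P ≤ ENNReal.ofReal (Kx * √t) := by
      rw [lintegral_congr_ae (g := fun ω ↦ ENNReal.ofReal ‖X s.toNNReal ω - x‖)
        (by filter_upwards [hX'e] with ω h; rw [h])]
      exact (hKx _ hs1).trans (ENNReal.ofReal_le_ofReal (by gcongr))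
    have hy : ∫⁻ ω, ENNReal.ofReal ‖Y' s.toNNReal ω - y‖ ∂P ≤ ENNReal.ofReal (Ky * √t) := by
      rw [lintegral_congr_ae (g := fun ω ↦ ENNReal.ofReal ‖Y s.toNNReal ω - y‖)
        (by filter_upwards [hY'e] with ω h; rw [h])]
      exact (hKy _ hs1).trans (ENNReal.ofReal_le_ofReal (by gcongr))
    simp_rw [hf, ENNReal.ofReal_mul hC0, ENNReal.ofReal_add (norm_nonneg _) (norm_nonneg _)]
    rw [lintegral_const_mul' _ _ ENNReal.ofReal_ne_top, lintegral_add_left (hmX _), mul_assoc,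
      ENNReal.ofReal_mul hC0, add_mul, ENNReal.ofReal_add (by positivity) (by positivity)]
    gcongr
  have hint := lintegral_intervalIntegral_le (P := P) (f := f)
    (fun s ↦ ((((hX'm _).sub_const x).norm.add ((hY'm _).sub_const y).norm).const_mul C))
    hfc (fun _ _ ↦ by positivity) t.2 hbound
  have heq : (∫ ω, Y t ω ∂P - ∫ ω, X t ω ∂P) - ((y - x) + (t : ℝ) • (b y - b x)) =
      ∫ ω, ((Y t ω - X t ω) - ((y - x) + (t : ℝ) • (b y - b x))) ∂P := by
    have hYX : Integrable (fun ω ↦ Y t ω - X t ω) P := hYi.sub hXi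
    rw [integral_sub hYX (integrable_const _), integral_sub hYi hXi]
    simp
  rw [heq, ← ENNReal.ofReal_le_ofReal_iff (by positivity), ofReal_norm]
  refine (enorm_integral_le_lintegral_enorm _).trans ?_
  simp_rw [← ofReal_norm]
  refine (lintegral_mono_ae (hpath.mono fun ω h ↦ ENNReal.ofReal_le_ofReal h)).trans
    (hint.trans_eq ?_)
  congr 1
  change (t : ℝ) * _ = _
  ring

theorem dirac_mem_finiteMoment {p : ℝ} (hp : 0 ≤ p) (x : EuclideanSpace ℝ (Fin d)) :
    Measure.dirac x ∈ finiteMoment p := by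
  refine ⟨inferInstance, ?_⟩
  rw [lintegral_dirac]
  exact ENNReal.rpow_lt_top_of_nonneg hp enorm_ne_top

theorem ofReal_inner_div_le_contractionCoeff (hb : BasicAssumption b) (hB : IsBrownian B P)
    (hX : ∀ x, IsSolution b σ B P x (X x)) {p : ℝ} (hp : 1 ≤ p) {t : ℝ≥0} (ht : t ≤ 1)
    {x y v : EuclideanSpace ℝ (Fin d)} (hxy : y ≠ x) (hv : ‖v‖ ≤ 1) :
    ENNReal.ofReal (inner ℝ v (∫ ω, X y t ω ∂P - ∫ ω, X x t ω ∂P) / ‖y - x‖) ≤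
      contractionCoeff P X p t := by
  have hp0 : 0 ≤ p := by linarith
  have hprob : ∀ x, IsProbabilityMeasure (P.map (X x t)) :=
    fun x ↦ Measure.isProbabilityMeasure_map ((hX x).aemeasurable t)
  have hi : ∀ x, Integrable id (P.map (X x t)) := fun x ↦ by
    rw [integrable_map_measure aestronglyMeasurable_id ((hX x).aemeasurable t)]
    exact (hX x).integrable hb hB ht
  have he : ∀ x, ∫ z, z ∂(P.map (X x t)) = ∫ ω, X x t ω ∂P := fun x ↦
    integral_map ((hX x).aemeasurable t) aestronglyMeasurable_id
  have hlaw : ∀ x, evolvedLaw P X t (Measure.dirac x) = P.map (X x t) :=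
    fun x ↦ Measure.dirac_bind (measurable_law hb hX t) x
  have hnum := ofReal_inner_integral_sub_le_wasserstein hp (hi y) (hi x) hv
  rw [he, he, ← hlaw, ← hlaw] at hnum
  have hne : Measure.dirac y ≠ Measure.dirac x := fun h ↦ hxy (dirac_eq_dirac_iff.1 h)
  refine le_trans ?_ (le_iSup₂_of_le _ (dirac_mem_finiteMoment hp0 y) <|
    le_iSup₂_of_le _ (dirac_mem_finiteMoment hp0 x) <| le_iSup_of_le hne le_rfl)
  rw [ENNReal.ofReal_div_of_pos (norm_pos_iff.2 (sub_ne_zero.2 hxy))]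
  refine ENNReal.div_le_div hnum ((wasserstein_dirac_le hp y x).trans_eq ?_)
  rw [edist_dist, dist_eq_norm]

/-- Take `y = x + εv` with `v · ∇b(x) v > r` and `ε` so small that the difference quotient along `v`
still exceeds `r`. This `ε` stays fixed as `t → 0`, so the constant of the mean expansion may depend
on it. -/
theorem exists_lt_inner_sub (hb : BasicAssumption b) (hd : 0 < d) {r : ℝ}
    (hr : r < -bakryEmeryCurvature b) :
    ∃ x y v : EuclideanSpace ℝ (Fin d), y ≠ x ∧ ‖v‖ ≤ 1 ∧ inner ℝ v (y - x) = ‖y - x‖ ∧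
      r * ‖y - x‖ ≤ inner ℝ v (b y - b x) := by
  obtain ⟨x, v, hv, h⟩ := exists_lt_inner_fderiv hd hr
  have h1 := ((hb.contDiff.differentiable (by norm_num)) x).hasFDerivAt.hasLineDerivAt v
  have h3 : Tendsto (fun s ↦ inner ℝ v (slope (fun t : ℝ ↦ b (x + t • v)) 0 s)) (𝓝[>] 0)
      (𝓝 (inner ℝ v (fderiv ℝ b x v))) :=
    tendsto_const_nhds.inner ((hasDerivAt_iff_tendsto_slope.1 h1).mono_left
      (nhdsWithin_mono _ fun _ hs ↦ ne_of_gt hs))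
  obtain ⟨ε, h4, hε⟩ := ((h3.eventually (lt_mem_nhds h)).and self_mem_nhdsWithin).exists
  have hε : 0 < ε := hε
  have hv0 : v ≠ 0 := norm_ne_zero_iff.1 (by simp [hv])
  have hn : ‖ε • v‖ = ε := by rw [norm_smul, hv, mul_one, Real.norm_of_nonneg hε.le]
  refine ⟨x, x + ε • v, v, by simp [hε.ne', hv0], hv.le, ?_, ?_⟩
  · rw [add_sub_cancel_left, hn, real_inner_smul_right, real_inner_self_eq_norm_sq, hv]
    simp
  · rw [slope_def_module, sub_zero, zero_smul, add_zero, real_inner_smul_right] at h4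
    rw [add_sub_cancel_left, hn]
    have h5 := mul_lt_mul_of_pos_right h4 hε
    rw [mul_right_comm, inv_mul_cancel₀ hε.ne', one_mul] at h5
    exact h5.le

theorem exists_le_toReal_contractionCoeff (hb : BasicAssumption b) (hd : 0 < d)
    (hB : IsBrownian B P) (hX : ∀ x, IsSolution b σ B P x (X x)) {p : ℝ} (hp : 1 ≤ p) {r : ℝ}
    (hr : r < -bakryEmeryCurvature b) :
    ∃ C : ℝ, ∀ t : ℝ≥0, t ≤ 1 →
      1 + r * t - C * (t * √t) ≤ (contractionCoeff P X p t).toReal := by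
  obtain ⟨x, y, v, hxy, hv, hv1, hv2⟩ := exists_lt_inner_sub hb hd hr
  obtain ⟨C, -, hC⟩ := (hX x).exists_norm_integral_sub_le hb hB (hX y)
  have hpos : 0 < ‖y - x‖ := norm_pos_iff.2 (sub_ne_zero.2 hxy)
  refine ⟨C / ‖y - x‖, fun t ht ↦ ?_⟩
  -- The upper bound rules out `∞`, which `toReal` would send to `0`.
  have hfin : contractionCoeff P X p t ≠ ∞ :=
    ((contractionCoeff_le hb hX hp t).trans_lt ENNReal.ofReal_lt_top).ne
  refine le_trans ?_ ((ENNReal.ofReal_le_iff_le_toReal hfin).1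
    (ofReal_inner_div_le_contractionCoeff hb hB hX hp ht hxy hv))
  rw [le_div_iff₀ hpos]
  set D := ∫ ω, X y t ω ∂P - ∫ ω, X x t ω ∂P with hD
  have h1 : -(C * (t * √t)) ≤ inner ℝ v (D - ((y - x) + (t : ℝ) • (b y - b x))) := by
    have h2 := abs_real_inner_le_norm v (D - ((y - x) + (t : ℝ) • (b y - b x)))
    have h3 := (mul_le_of_le_one_left (norm_nonneg _) hv).trans (hC t ht)
    exact neg_le_of_abs_le (h2.trans h3)
  rw [inner_sub_right, inner_add_right, real_inner_smul_right, hv1] at h1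
  have h4 := mul_le_mul_of_nonneg_left hv2 t.2
  have h5 : C / ‖y - x‖ * (t * √t) * ‖y - x‖ = C * (t * √t) := by field_simp
  change (t : ℝ) * _ ≤ (t : ℝ) * _ at h4
  rw [sub_mul, h5]
  nlinarith

end LowerBound

end WassersteinContraction

theorem proposition3 {d : ℕ} (hd : 0 < d)
    (b : EuclideanSpace ℝ (Fin d) → EuclideanSpace ℝ (Fin d))
    (hb : WassersteinContraction.BasicAssumption b)
    (σ : Matrix (Fin d) (Fin d) ℝ)
    {Ω : Type*} [MeasurableSpace Ω] (P : Measure Ω) [IsProbabilityMeasure P]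
    (B : ℝ≥0 → Ω → EuclideanSpace ℝ (Fin d)) (hB : WassersteinContraction.IsBrownian B P)
    (X : EuclideanSpace ℝ (Fin d) → ℝ≥0 → Ω → EuclideanSpace ℝ (Fin d))
    (hX : ∀ x, WassersteinContraction.IsSolution b σ B P x (X x))
    (p : ℝ) (hp : 1 ≤ p) :
    (∀ t : ℝ≥0, WassersteinContraction.contractionCoeff P X p t
      ≤ ENNReal.ofReal (Real.exp (-WassersteinContraction.bakryEmeryCurvature b * t))) ∧
    (fun t : ℝ≥0 ↦ (WassersteinContraction.contractionCoeff P X p t).toReal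
        - (1 - WassersteinContraction.bakryEmeryCurvature b * t))
      =o[𝓝[>] 0] (fun t : ℝ≥0 ↦ (t : ℝ)) := by
  refine ⟨fun t ↦ WassersteinContraction.contractionCoeff_le hb hX hp t, ?_⟩
  set l := WassersteinContraction.bakryEmeryCurvature b with hl
  rw [isLittleO_iff]
  intro c hc
  -- Of the allowed error `c t`, half is spent on taking the slope below `-l` and half on absorbing
  -- `C t √t`.
  obtain ⟨C, hC⟩ := WassersteinContraction.exists_le_toReal_contractionCoeff hb hd hB hX hp
    (r := -l - c / 2) (by linarith)
  have hcoe : Tendsto (fun t : ℝ≥0 ↦ (t : ℝ)) (𝓝[>] 0) (𝓝 0) :=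
    (NNReal.continuous_coe.tendsto' 0 0 rfl).mono_left nhdsWithin_le_nhds
  have hsqrt : Tendsto (fun t : ℝ≥0 ↦ C * √(t : ℝ)) (𝓝[>] 0) (𝓝 0) := by
    simpa using ((Real.continuous_sqrt.tendsto 0).comp hcoe).const_mul C
  have hlin : Tendsto (fun t : ℝ≥0 ↦ -l * (t : ℝ)) (𝓝[>] 0) (𝓝 0) := by
    simpa using hcoe.const_mul (-l)
  have hsq : Tendsto (fun t : ℝ≥0 ↦ l ^ 2 * (t : ℝ)) (𝓝[>] 0) (𝓝 0) := by
    simpa using hcoe.const_mul (l ^ 2)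
  filter_upwards [hcoe.eventually (gt_mem_nhds one_pos),
    hsqrt.eventually (gt_mem_nhds (half_pos hc)), hsq.eventually (gt_mem_nhds hc),
    hlin.abs.eventually (gt_mem_nhds (show |(0 : ℝ)| < 1 by simp))] with t h1 h2 h3 h4
  have ht0 : (0 : ℝ) ≤ t := t.2
  have hlow := hC t (by exact_mod_cast h1.le)
  have hup := ENNReal.toReal_le_of_le_ofReal (Real.exp_pos _).le
    (WassersteinContraction.contractionCoeff_le hb hX hp t)
  -- For the upper side, `e^u ≤ 1 + u + u²` with `u = -l t`, and `u² = t (l² t) ≤ c t` near zero.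
  have hexp := (abs_le.1 (Real.abs_exp_sub_one_sub_id_le h4.le)).2
  have h5 := mul_le_mul_of_nonneg_left h2.le ht0
  have h6 := mul_le_mul_of_nonneg_left h3.le ht0
  rw [Real.norm_eq_abs, Real.norm_of_nonneg ht0, abs_le]
  constructor <;> nlinarith
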